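/- Let $D$ be one of the affine Dynkin diagrams $\tilde D_4,\tilde E_6,\tilde E_7,\tilde E_8$; it is a star with $m$ legs whose lengths (numbers of vertices including the node) are $(d_1,\dots,d_m)=(2,2,2,2),(3,3,3),(2,4,4),(2,3,6)$ respectively. Put $\ell=d_m$, let $n\ge 1$ be an integer, and let $G=PGL_{n\ell}(\mathbb C)$. For positive integers $s\mid r$, let $\mathfrak b\subset\mathfrak{sl}_r(\mathbb C)$ be the subalgebra of upper triangular matrices and $f_i=E_{i+1,i}$ $(1\le i\le r-1)$. Let $\mathfrak p(s,r)\subset\mathfrak{sl}_r$ be the subalgebra generated by $\mathfrak b$ and the $f_i$ with $\frac rs\nmid i$; let $\mathfrak p''(s,r)$ be the subalgebra generated by $\mathfrak b$ and the $f_i$ with $\frac rs\nmid i$ and $i\neq\frac rs-1$; and, for $s\ge 2$, let $\tilde{\mathfrak p}''(s,r)$ be the subalgebra generated by $\mathfrak p''(s,r)$ and $f_{r/s}$. For $1\le i\le m-1$ let $P_i\subset G$ be the parabolic subgroup with Lie algebra $\mathfrak p(d_i,n\ell)$, and let $\tilde P''(\ell,n\ell)\subset G$ be the parabolic subgroup with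 Lie algebra $\tilde{\mathfrak p}''(\ell,n\ell)$. Then the diagonal action of $G$ by left translations on the variety $$X=G/P_1\times\dots\times G/P_{m-1}\times G/\tilde P''(\ell,n\ell)$$ has a Zariski open orbit $X_*$, and the action of $G$ on $X_*$ is free. -/

import Mathlib

/-- The group `PGL_r(ℂ)`: invertible matrices modulo the centre (the scalar matrices). -/
abbrev PGL (r : ℕ) : Type := GL (Fin r) ℂ ⧸ Subgroup.center (GL (Fin r) ℂ)

/-- The projection `GL_r(ℂ) → PGL_r(ℂ)`. -/
def toPGL (r : ℕ) : GL (Fin r) ℂ →* PGL r :=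
  QuotientGroup.mk' (Subgroup.center (GL (Fin r) ℂ))

open scoped Topology

attribute [local instance] LieRing.ofAssociativeRing

/-! ### Parabolic subalgebras of `sl_r` -/

/-- The Borel subalgebra of upper triangular matrices in `sl_r(ℂ)`, as a set of matrices. -/
def upperTriangularSl (r : ℕ) : Set (Matrix (Fin r) (Fin r) ℂ) :=
  {x | x ∈ LieAlgebra.SpecialLinear.sl (Fin r) ℂ ∧ x.BlockTriangular id}

/-- The set of the elements `f_i = E_{i+1,i}`, `1 ≤ i ≤ r - 1`, `i ∈ S`. The indices `i` and the
matrix units `E` are numbered from `1`, whereas `Fin r` starts at `0`: the entry `(b, a)` with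
`b = a + 1` is that of `f_i` for `i = b`. -/
def lowerGenerators (r : ℕ) (S : Set ℕ) : Set (Matrix (Fin r) (Fin r) ℂ) :=
  {x | ∃ a b : Fin r, (b : ℕ) = a + 1 ∧ (b : ℕ) ∈ S ∧ x = Matrix.single b a 1}

/-- `𝔭(s,r)`: generated by the upper triangular matrices and `f_i`, `r/s ∤ i`. -/
def parabolicAlg (s r : ℕ) : LieSubalgebra ℂ (Matrix (Fin r) (Fin r) ℂ) :=
  LieSubalgebra.lieSpan ℂ _
    (upperTriangularSl r ∪ lowerGenerators r {i | ¬ r / s ∣ i})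

/-- `𝔭''(s,r)`: generated by the upper triangular matrices and `f_i`, `r/s ∤ i`, `i ≠ r/s - 1`. -/
def parabolicAlg'' (s r : ℕ) : LieSubalgebra ℂ (Matrix (Fin r) (Fin r) ℂ) :=
  LieSubalgebra.lieSpan ℂ _
    (upperTriangularSl r ∪ lowerGenerators r {i | i ≠ r / s - 1 ∧ ¬ r / s ∣ i})

/-- The subalgebra generated by `𝔭''(s,r)` and `f_{r/s}`. -/
def parabolicAlgTilde'' (s r : ℕ) : LieSubalgebra ℂ (Matrix (Fin r) (Fin r) ℂ) :=
  LieSubalgebra.lieSpan ℂ _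
    ((parabolicAlg'' s r : Set (Matrix (Fin r) (Fin r) ℂ)) ∪ lowerGenerators r {r / s})

/-- The connected subgroup of `PGL_r(ℂ)` with Lie algebra `𝔭 ⊆ sl_r = pgl_r`: the subgroup
generated by the images of `exp x`, `x ∈ 𝔭`. (Parabolic subgroups of `PGL_r` are connected, so for
a parabolic subalgebra this is the corresponding parabolic subgroup.) -/
def groupOfLieAlg {r : ℕ} (p : LieSubalgebra ℂ (Matrix (Fin r) (Fin r) ℂ)) : Subgroup (PGL r) :=
  (Subgroup.closure
    {g : GL (Fin r) ℂ | ∃ x ∈ p, (g : Matrix (Fin r) (Fin r) ℂ) = NormedSpace.exp x}).map (toPGL r)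

/-! ### The Zariski topology on a product of homogeneous spaces of `PGL_r` -/

/-- The Zariski topology on the variety `GL_r(ℂ)^m`: the sets `{g | f(g) ≠ 0}`, where `f` is a
polynomial in the entries of the `m` matrices, form a basis of open sets. -/
@[reducible] def zariskiGL (m r : ℕ) : TopologicalSpace (Fin m → GL (Fin r) ℂ) :=
  TopologicalSpace.generateFrom
    {U | ∃ f : MvPolynomial (Fin m × Fin r × Fin r) ℂ,
      U = {g | MvPolynomial.eval
        (fun k => (g k.1 : Matrix (Fin r) (Fin r) ℂ) k.2.1 k.2.2) f ≠ 0}}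

/-- The Zariski topology on `PGL_r/P_1 × ⋯ × PGL_r/P_m = GL_r^m / ∏ P̂_i`, where `P̂_i` is the
preimage of `P_i`: the quotient topology of the Zariski topology on `GL_r^m`. -/
@[reducible] def zariskiProd {m r : ℕ} (P : Fin m → Subgroup (PGL r)) :
    TopologicalSpace ((i : Fin m) → PGL r ⧸ P i) :=
  TopologicalSpace.coinduced
    (fun (g : Fin m → GL (Fin r) ℂ) (i : Fin m) => (QuotientGroup.mk (toPGL r (g i)) : PGL r ⧸ P i))
    (zariskiGL m r)

/-! ### The star-shaped affine Dynkin diagrams -/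

/-- The finite Dynkin types `D_4, E_6, E_7, E_8`: those whose affine Dynkin diagram is
star-shaped. -/
inductive StarType : Type
  | D4 | E6 | E7 | E8

namespace StarType

/-- The number `m` of legs of the affine diagram. -/
def m : StarType → ℕ
  | D4 => 4
  | E6 => 3
  | E7 => 3
  | E8 => 3

/-- The leg lengths `d_1 ≤ ⋯ ≤ d_m` (numbers of vertices, with the node). -/
def d : (T : StarType) → Fin T.m → ℕ
  | D4 => ![2, 2, 2, 2]
  | E6 => ![3, 3, 3]
  | E7 => ![2, 4, 4]
  | E8 => ![2, 3, 6]

/-- The last leg. -/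
def last (T : StarType) : Fin T.m := ⟨T.m - 1, by cases T <;> decide⟩

/-- `ℓ = d_m`. -/
def ell (T : StarType) : ℕ := T.d T.last

/-- The parabolic subgroups `P_1, …, P_{m-1}, P̃''(ℓ, nℓ)` of `PGL_{nℓ}(ℂ)`. -/
def parabolic (T : StarType) (n : ℕ) (i : Fin T.m) : Subgroup (PGL (n * T.ell)) :=
  if i = T.last then groupOfLieAlg (parabolicAlgTilde'' T.ell (n * T.ell))
  else groupOfLieAlg (parabolicAlg (T.d i) (n * T.ell))

/-- `X = G/P_1 × ⋯ × G/P_{m-1} × G/P̃''(ℓ, nℓ)`, `G = PGL_{nℓ}(ℂ)`, on which `G` acts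
diagonally by left translations. -/
abbrev X (T : StarType) (n : ℕ) : Type :=
  (i : Fin T.m) → PGL (n * T.ell) ⧸ T.parabolic n i

end StarType

/-!
A point of `X` is a configuration of partial flags in `ℂ^r`, `r = nℓ`, hence a representation of the
star-shaped affine quiver. Its dimension vector is `nδ - α₀`, where `δ` is the minimal imaginary
root and `α₀` the simple root at the tip of the longest leg; this is a real root, and the open orbit
consists of the exceptional representations of that dimension.

*Parabolic subgroups.* The Lie algebras in question consist of all trace zero block upper triangular
matrices (`lieSpan_lowerGenerators`), and their groups of the classes of all invertible block upper
triangular matrices (`toPGL_mem_groupOfLieAlg_iff`), since the group of invertible elements of the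
algebra of block triangular matrices is connected, hence generated by exponentials.

*Existence.* For `n = 1` the dimension vector is the highest root of the finite diagram, and explicit
flags in `ℂ^ℓ` with only scalar endomorphisms are written down
(`StarType.exists_rigid_flags`). For general `n` these flags are tensored with `ℂ^n`, which makes
the endomorphism ring `Mat_n(ℂ)`, and the missing subspace of dimension `n - 1` is placed in the
subspace `ℂ² ⊗ ℂ^n` of dimension `2n` as a preprojective Kronecker module; only scalars
preserve it (`exists_rigid_flags_kronecker`). So stabilizers in `PGL_r` are trivial.

*Openness.* Homomorphisms `h` from the fixed configuration `x` to a configuration `g` are the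
solutions of `dim X` linear equations in `r²` unknowns, and `dim X = r² - 1`
(`StarType.card_belowBlocks`). So the maximal minors give a solution that depends polynomially on
`g`. At the configurations isomorphic to `x` the solutions form a line spanned by an isomorphism;
thus the determinant of the solution formed by the minors is nonzero there, and conversely its
nonvanishing gives an isomorphism (`isOpen_setOf_flags_isomorphic`).
-/

/-! ### Exponentials of block triangular matrices -/

theorem Matrix.GeneralLinearGroup.blockTriangular_inv {r : ℕ} {β : Fin r → ℕ} {g : GL (Fin r) ℂ}
    (hg : (g : Matrix (Fin r) (Fin r) ℂ).BlockTriangular β) :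
    ((g⁻¹ : GL (Fin r) ℂ) : Matrix (Fin r) (Fin r) ℂ).BlockTriangular β := by
  have := g.isUnit.invertible
  rw [Matrix.coe_units_inv]
  exact Matrix.blockTriangular_inv_of_blockTriangular hg

/-- In a finite dimensional subalgebra `A`, every element near `1` is an exponential of an element
of `A`. -/
theorem Subalgebra.eventually_eq_exp {B : Type*} [NormedRing B] [NormedAlgebra ℂ B]
    [FiniteDimensional ℂ B] (A : Subalgebra ℂ B) {c : ℂ → B} (hc : Continuous c)
    (hcA : ∀ z, c z ∈ A) {z₀ : ℂ} (h0 : c z₀ = 1) :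
    ∀ᶠ z in 𝓝 z₀, ∃ x ∈ A, c z = NormedSpace.exp x := by
  have : CompleteSpace A := FiniteDimensional.complete ℂ A
  have : CompleteSpace B := FiniteDimensional.complete ℂ B
  let := NormedAlgebra.restrictScalars ℚ ℂ B
  let := NormedAlgebra.restrictScalars ℚ ℂ A
  have hs := hasStrictFDerivAt_exp_zero (𝕂 := ℂ) (𝔸 := A)
  have hm : Filter.map NormedSpace.exp (𝓝 (0 : A)) = 𝓝 1 := by
    rw [hs.map_nhds_eq_of_surj (LinearMap.range_eq_top.2 fun x => ⟨x, rfl⟩), NormedSpace.exp_zero]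
  have hc' : Filter.Tendsto (fun z => (⟨c z, hcA z⟩ : A)) (𝓝 z₀) (𝓝 1) :=
    ((hc.subtype_mk hcA).tendsto z₀).trans (by rw [show (⟨c z₀, hcA z₀⟩ : A) = 1 from Subtype.ext h0])
  have hr : Set.range (NormedSpace.exp : A → A) ∈ 𝓝 (1 : A) := hm ▸ Filter.range_mem_map
  filter_upwards [hc' hr] with z hz
  obtain ⟨x, hx⟩ := hz
  exact ⟨x, x.2, by
    simpa [hx] using NormedSpace.map_exp A.val continuous_subtype_val x⟩

open scoped Matrix.Norms.Operator in
theorem eventually_eq_exp_blockTriangular {r : ℕ} (β : Fin r → ℕ)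
    {c : ℂ → Matrix (Fin r) (Fin r) ℂ} (hc : Continuous c) (hcβ : ∀ z, (c z).BlockTriangular β)
    {z₀ : ℂ} (h0 : c z₀ = 1) :
    ∀ᶠ z in 𝓝 z₀, ∃ x : Matrix (Fin r) (Fin r) ℂ, x.BlockTriangular β ∧ c z = NormedSpace.exp x :=
  (Matrix.blockTriangularSubalgebra ℂ ℂ β).eventually_eq_exp hc hcβ h0

/-- Over `ℂ` the group of invertible block triangular matrices is generated by exponentials: the
exponentials fill a neighbourhood of `1`, and any `g` is joined to `1` inside the group by the
matrices `1 + z (g - 1)`, where `z` avoids the finitely many zeros of the determinant. -/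
theorem mem_closure_exp_blockTriangular {r : ℕ} {β : Fin r → ℕ} {g : GL (Fin r) ℂ}
    (hg : (g : Matrix (Fin r) (Fin r) ℂ).BlockTriangular β) :
    g ∈ Subgroup.closure {u : GL (Fin r) ℂ | ∃ x : Matrix (Fin r) (Fin r) ℂ,
      x.BlockTriangular β ∧ (u : Matrix (Fin r) (Fin r) ℂ) = NormedSpace.exp x} := by
  set H := Subgroup.closure {u : GL (Fin r) ℂ | ∃ x : Matrix (Fin r) (Fin r) ℂ,
      x.BlockTriangular β ∧ (u : Matrix (Fin r) (Fin r) ℂ) = NormedSpace.exp x} with hH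
  let c : ℂ → Matrix (Fin r) (Fin r) ℂ := fun z => 1 + z • ((g : Matrix (Fin r) (Fin r) ℂ) - 1)
  have hc : Continuous c := by fun_prop
  have hcβ : ∀ z, (c z).BlockTriangular β := fun z =>
    (Matrix.blockTriangularSubalgebra ℂ ℂ β).add_mem (one_mem _)
      ((Matrix.blockTriangularSubalgebra ℂ ℂ β).smul_mem (sub_mem hg (one_mem _)) z)
  let p : Polynomial ℂ := (1 + (Polynomial.X : Polynomial ℂ) •
    ((g : Matrix (Fin r) (Fin r) ℂ) - 1).map Polynomial.C).det
  have hp : ∀ z, p.eval z = (c z).det := by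
    intro z
    rw [← Polynomial.coe_evalRingHom, RingHom.map_det]
    congr 1
    ext i j
    by_cases hij : i = j <;> simp [c, hij, mul_comm z]
  have hp0 : p ≠ 0 := by
    intro h
    have := hp 0
    simp [c, h] at this
  have hU : IsPreconnected {z | (c z).det ≠ 0} := by
    have : ({z | (c z).det ≠ 0} : Set ℂ) = {z | p.IsRoot z}ᶜ := by
      ext z; simp [← hp]
    rw [this]
    exact ((Polynomial.finite_setOfPred_isRoot hp0).countable.isConnected_compl_of_one_lt_rank
      (by simp)).2
  let u : ∀ z, (c z).det ≠ 0 → GL (Fin r) ℂ := fun z hz =>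
    Matrix.GeneralLinearGroup.mkOfDetNeZero (c z) hz
  have key : ∀ z w, (c z).det ≠ 0 → (c w).det ≠ 0 →
      ∀ (hz : (c z).det ≠ 0) (hw : (c w).det ≠ 0), (u z hz)⁻¹ * u w hw ∈ H := by
    intro z w hz hw
    refine hU.induction₂
      (fun z w => ∀ (hz : (c z).det ≠ 0) (hw : (c w).det ≠ 0), (u z hz)⁻¹ * u w hw ∈ H)
      ?_ ?_ ?_ hz hw
    · intro z hz
      have hev := eventually_eq_exp_blockTriangular β
        (c := fun w => (((u z hz)⁻¹ : GL (Fin r) ℂ) : Matrix (Fin r) (Fin r) ℂ) * c w)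
        (continuous_const.mul hc)
        (fun w => (Matrix.GeneralLinearGroup.blockTriangular_inv (hcβ z)).mul (hcβ w)) (z₀ := z)
        ((u z hz).inv_mul)
      filter_upwards [nhdsWithin_le_nhds hev] with w hw
      obtain ⟨x, hx, he⟩ := hw
      exact fun _ _ => Subgroup.subset_closure ⟨x, hx, he⟩
    · intro x y z hx hy hz h1 h2 h3 h4
      have := H.mul_mem (h1 h3 hy) (h2 hy h4)
      simpa [mul_assoc] using this
    · intro x y hx hy h1 h2 h3
      have := H.inv_mem (h1 h3 h2)
      simpa [mul_inv_rev] using this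
  have h0 : (c 0).det ≠ 0 := by simp [c]
  have h1 : (c 1).det ≠ 0 := by
    simpa [c] using (Matrix.GeneralLinearGroup.det_ne_zero g)
  have := key 0 1 h0 h1 h0 h1
  have e0 : u 0 h0 = 1 := Units.ext (by simp [u, c, Matrix.GeneralLinearGroup.mkOfDetNeZero])
  have e1 : u 1 h1 = g := Units.ext (by simp [u, c, Matrix.GeneralLinearGroup.mkOfDetNeZero])
  simpa [e0, e1] using this

/-! ### Parabolic subalgebras and subgroups -/

/-- The trace zero block triangular matrices, as a Lie algebra. -/
def slBlockTriangular {r : ℕ} (β : Fin r → ℕ) : LieSubalgebra ℂ (Matrix (Fin r) (Fin r) ℂ) where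
  carrier := {x | x.trace = 0 ∧ x.BlockTriangular β}
  add_mem' h h' := ⟨by simp [h.1, h'.1], h.2.add h'.2⟩
  zero_mem' := ⟨by simp, Matrix.blockTriangular_zero⟩
  smul_mem' c x h := ⟨by simp [h.1],
    (Matrix.blockTriangularSubalgebra ℂ ℂ β).smul_mem h.2 c⟩
  lie_mem' {x y} h h' := ⟨by rw [Ring.lie_def, Matrix.trace_sub, Matrix.trace_mul_comm, sub_self],
    (h.2.mul h'.2).sub (h'.2.mul h.2)⟩

theorem lieSpan_lowerGenerators {r : ℕ} {S : Set ℕ} {β : ℕ → ℕ} (hβ : Monotone β)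
    (hS : ∀ i, i + 1 < r → (i + 1 ∈ S ↔ β (i + 1) = β i)) :
    LieSubalgebra.lieSpan ℂ (Matrix (Fin r) (Fin r) ℂ) (upperTriangularSl r ∪ lowerGenerators r S) =
      slBlockTriangular fun a => β a := by
  apply le_antisymm
  · rw [LieSubalgebra.lieSpan_le]
    rintro x (⟨h1, h2⟩ | ⟨a, b, hab, hb, rfl⟩)
    · exact ⟨h1, fun i j hij => h2 (hβ.reflect_lt hij)⟩
    · refine ⟨Matrix.trace_single_eq_of_ne _ _ _ (by rintro rfl; omega),
        Matrix.blockTriangular_single ?_ 1⟩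
      have := (hS a (by omega)).1 (hab ▸ hb)
      simp [hab, this]
  · set K := LieSubalgebra.lieSpan ℂ (Matrix (Fin r) (Fin r) ℂ)
      (upperTriangularSl r ∪ lowerGenerators r S) with hK
    have hup : ∀ x, x ∈ upperTriangularSl r → x ∈ K := fun x hx =>
      LieSubalgebra.subset_lieSpan (Or.inl hx)
    -- the matrix units below the diagonal are iterated brackets of the `f_i`
    have hlow : ∀ k : ℕ, ∀ a b : Fin r, (b : ℕ) = a + k + 1 → β b = β a →
        Matrix.single b a (1 : ℂ) ∈ K := by
      intro k
      induction k with
      | zero =>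
        intro a b hab he
        refine LieSubalgebra.subset_lieSpan (Or.inr ⟨a, b, hab, ?_, rfl⟩)
        have := (hS a (by omega)).2 (by rw [← he, hab])
        simpa [hab] using this
      | succ k ih =>
        intro a b hab he
        let m : Fin r := ⟨a + k + 1, by omega⟩
        have h1 : β a ≤ β m := hβ (by simp [m]; omega)
        have h2 : β m ≤ β b := hβ (by simp [m]; omega)
        have e1 := ih a m rfl (by omega)
        have e2 : Matrix.single b m (1 : ℂ) ∈ K := by
          refine LieSubalgebra.subset_lieSpan (Or.inr ⟨m, b, by simp [m]; omega, ?_, rfl⟩)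
          have := (hS m (by simp [m]; omega)).2 (by
            have : (m : ℕ) + 1 = b := by simp [m]; omega
            rw [this]; omega)
          have h3 : (m : ℕ) + 1 = b := by simp [m]; omega
          rwa [h3] at this
        have := K.lie_mem e2 e1
        rw [Ring.lie_def, Matrix.single_mul_single_same,
          Matrix.single_mul_single_of_ne _ _ _ _ (by
            intro h; rw [Fin.ext_iff] at h; omega)] at this
        simpa using this
    rintro x ⟨hx1, hx2⟩
    -- split `x` into its upper triangular part and its part below the diagonal
    let y : Matrix (Fin r) (Fin r) ℂ := Matrix.of fun i j => if j < i then x i j else 0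
    have hy : y ∈ K := by
      rw [Matrix.matrix_eq_sum_single y]
      refine sum_mem fun i _ => sum_mem fun j _ => ?_
      by_cases hij : j < i
      · by_cases hb : β i = β j
        · have := K.smul_mem (x i j) (hlow (i - j - 1) j i (by
            have : (j : ℕ) < i := hij
            omega) hb)
          simpa [y, hij, Matrix.smul_single] using this
        · have : x i j = 0 := hx2 (lt_of_le_of_ne (hβ (Fin.le_def.1 hij.le)) (Ne.symm hb))
          simp [y, this]
      · simp [y, hij]
    have hz : x - y ∈ K := by
      apply hup
      refine ⟨?_, fun i j hij => ?_⟩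
      · change (x - y).trace = 0
        rw [Matrix.trace_sub, hx1, zero_sub, neg_eq_zero]
        simp [Matrix.trace, y]
      · have : j < i := hij
        simp [y, this]
    simpa using K.add_mem hz hy

theorem toPGL_eq_one_of_scalar {r : ℕ} {g : GL (Fin r) ℂ} {c : ℂ}
    (h : (g : Matrix (Fin r) (Fin r) ℂ) = c • 1) : toPGL r g = 1 := by
  refine (QuotientGroup.eq_one_iff g).2
    (Matrix.GeneralLinearGroup.mem_center_iff_val_mem_range_scalar.2 ⟨c, ?_⟩)
  rw [h]; ext i j; simp [Matrix.diagonal_apply, Matrix.one_apply]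

/-- The connected group of the Lie algebra of trace zero block triangular matrices consists of the
classes of the invertible block triangular matrices. -/
theorem toPGL_mem_groupOfLieAlg_iff {r : ℕ} (hr : 0 < r) {β : Fin r → ℕ} {g : GL (Fin r) ℂ} :
    toPGL r g ∈ groupOfLieAlg (slBlockTriangular β) ↔
      (g : Matrix (Fin r) (Fin r) ℂ).BlockTriangular β := by
  constructor
  · rintro ⟨u, hu, hug⟩
    have hu' : (u : Matrix (Fin r) (Fin r) ℂ).BlockTriangular β := by
      refine Subgroup.closure_induction (p := fun (u : GL (Fin r) ℂ) _ =>
        (u : Matrix (Fin r) (Fin r) ℂ).BlockTriangular β) ?_ ?_ ?_ ?_ hu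
      · rintro v ⟨x, hx, hv⟩
        rw [hv]
        exact Matrix.BlockTriangular.exp hx.2
      · exact Matrix.blockTriangular_one
      · intro v w _ _ h1 h2
        exact h1.mul h2
      · intro v _ h
        exact Matrix.GeneralLinearGroup.blockTriangular_inv h
    have hc : u⁻¹ * g ∈ Subgroup.center (GL (Fin r) ℂ) := QuotientGroup.eq.1 hug
    obtain ⟨c, hc⟩ := Matrix.GeneralLinearGroup.mem_center_iff_val_mem_range_scalar.1 hc
    have : (g : Matrix (Fin r) (Fin r) ℂ) = u * Matrix.scalar (Fin r) c := by
      rw [hc, Units.val_mul, ← mul_assoc, Units.mul_inv, one_mul]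
    rw [this]
    exact hu'.mul (Matrix.blockTriangular_diagonal _)
  · intro hg
    refine Subgroup.closure_induction (p := fun u _ => toPGL r u ∈ groupOfLieAlg
      (slBlockTriangular β)) ?_ ?_ ?_ ?_ (mem_closure_exp_blockTriangular hg)
    · rintro v ⟨x, hx, hv⟩
      -- split off the scalar part of `x`
      have hr' : (r : ℂ) ≠ 0 := by exact_mod_cast hr.ne'
      let t : ℂ := x.trace / r
      let x₀ : Matrix (Fin r) (Fin r) ℂ := x - t • 1
      have hx₀ : x₀ ∈ slBlockTriangular β := by
        refine ⟨?_, (Matrix.blockTriangularSubalgebra ℂ ℂ β).sub_mem hx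
          (Subalgebra.smul_mem _ (one_mem _) _)⟩
        simp [x₀, t, hr']
      have hxe : x = x₀ + t • 1 := by simp [x₀]
      obtain ⟨w, hw⟩ := Matrix.isUnit_exp x₀
      have hvw : toPGL r v = toPGL r w := by
        symm
        refine QuotientGroup.eq.2
          (Matrix.GeneralLinearGroup.mem_center_iff_val_mem_range_scalar.2 ⟨Complex.exp t, ?_⟩)
        have hcomm : Commute x₀ (t • (1 : Matrix (Fin r) (Fin r) ℂ)) :=
          (Commute.one_right x₀).smul_right t
        have ht : NormedSpace.exp (t • (1 : Matrix (Fin r) (Fin r) ℂ)) =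
            Matrix.scalar (Fin r) (Complex.exp t) := by
          have : t • (1 : Matrix (Fin r) (Fin r) ℂ) = Matrix.diagonal fun _ => t := by
            ext i j; simp [Matrix.diagonal_apply, Matrix.one_apply]
          rw [this, Matrix.exp_diagonal]
          ext i j
          simp [Matrix.diagonal_apply, Pi.exp_def, Complex.exp_eq_exp_ℂ]
        rw [Units.val_mul, hv, hxe, Matrix.exp_add_of_commute _ _ hcomm, ht, ← hw, ← mul_assoc,
          Units.inv_mul, one_mul]
      rw [hvw]
      exact ⟨w, Subgroup.subset_closure ⟨x₀, hx₀, hw⟩, rfl⟩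
    · rw [map_one]; exact one_mem _
    · intro v w _ _ h1 h2
      rw [map_mul]; exact mul_mem h1 h2
    · intro v _ h
      rw [map_inv]; exact inv_mem h

/-! ### Openness of an orbit of flags with scalar endomorphisms -/

/-- The positions `(i, a, b)` of the entries that vanish in block triangular matrices with respect
to `β i`. -/
abbrev BelowBlocks {m r : ℕ} (β : Fin m → Fin r → ℕ) : Type :=
  {t : Fin m × Fin r × Fin r // β t.1 t.2.2 < β t.1 t.2.1}

/-- The square matrix, in the `r²` unknown entries of `h`, of the linear equations
`(D i * h * Y i) a b = 0` for `(i, a, b) ∈ BelowBlocks β`, with the entry `h p.1 p.2` as one further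
row; `e` enumerates the rows. -/
def flagSystem {S : Type*} [CommRing S] {m r : ℕ} {β : Fin m → Fin r → ℕ}
    (e : Fin r × Fin r ≃ Option (BelowBlocks β)) (p : Fin r × Fin r)
    (D Y : Fin m → Matrix (Fin r) (Fin r) S) : Matrix (Fin r × Fin r) (Fin r × Fin r) S :=
  Matrix.of fun k q => (e k).elim (if q = p then 1 else 0)
    fun t => D t.1.1 t.1.2.1 q.1 * Y t.1.1 q.2 t.1.2.2

/-- The solution of `(D i * h * Y i) a b = 0`, `(i, a, b) ∈ BelowBlocks β`, formed by the maximal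
minors of the system. -/
def flagSolution {S : Type*} [CommRing S] {m r : ℕ} {β : Fin m → Fin r → ℕ}
    (e : Fin r × Fin r ≃ Option (BelowBlocks β)) (p : Fin r × Fin r)
    (D Y : Fin m → Matrix (Fin r) (Fin r) S) : Matrix (Fin r) (Fin r) S :=
  Matrix.of fun a b => (flagSystem e p D Y).adjugate (a, b) (e.symm none)

section FlagSystem

variable {S : Type*} [CommRing S] {m r : ℕ} {β : Fin m → Fin r → ℕ}
  (e : Fin r × Fin r ≃ Option (BelowBlocks β)) (p : Fin r × Fin r)
  (D Y : Fin m → Matrix (Fin r) (Fin r) S)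

theorem flagSystem_map {S' : Type*} [CommRing S'] (f : S →+* S') :
    (flagSystem e p D Y).map f = flagSystem e p (fun i => (D i).map f) (fun i => (Y i).map f) := by
  ext k q
  rcases h : e k with _ | t
  · by_cases hq : q = p <;> simp [flagSystem, h, hq]
  · simp [flagSystem, h]

theorem flagSolution_map {S' : Type*} [CommRing S'] (f : S →+* S') :
    (flagSolution e p D Y).map f =
      flagSolution e p (fun i => (D i).map f) (fun i => (Y i).map f) := by
  ext a b
  simp only [flagSolution, Matrix.map_apply, Matrix.of_apply]
  rw [← flagSystem_map, ← RingHom.mapMatrix_apply, ← RingHom.map_adjugate]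
  rfl

theorem flagSystem_mulVec_none (h : Matrix (Fin r) (Fin r) S) :
    (flagSystem e p D Y).mulVec (fun q => h q.1 q.2) (e.symm none) = h p.1 p.2 := by
  simp [flagSystem, Matrix.mulVec, dotProduct]

theorem flagSystem_mulVec_some (h : Matrix (Fin r) (Fin r) S) (t : BelowBlocks β) :
    (flagSystem e p D Y).mulVec (fun q => h q.1 q.2) (e.symm (some t)) =
      (D t.1.1 * h * Y t.1.1) t.1.2.1 t.1.2.2 := by
  simp only [flagSystem, Matrix.mulVec, dotProduct, Matrix.of_apply, Equiv.apply_symm_apply,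
    Option.elim_some, Fintype.sum_prod_type, Matrix.mul_apply, Finset.sum_mul]
  rw [Finset.sum_comm]
  exact Finset.sum_congr rfl fun _ _ => Finset.sum_congr rfl fun _ _ => by ring

theorem flagSystem_mulVec_flagSolution (k : Fin r × Fin r) :
    (flagSystem e p D Y).mulVec (fun q => flagSolution e p D Y q.1 q.2) k =
      if k = e.symm none then (flagSystem e p D Y).det else 0 := by
  have := congrFun (congrFun (Matrix.mul_adjugate (flagSystem e p D Y)) k) (e.symm none)
  simpa [Matrix.mul_apply, Matrix.mulVec, dotProduct, flagSolution, Matrix.one_apply] using this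

theorem flagSolution_apply_self : flagSolution e p D Y p.1 p.2 = (flagSystem e p D Y).det := by
  rw [← flagSystem_mulVec_none e p D Y (flagSolution e p D Y),
    flagSystem_mulVec_flagSolution, if_pos rfl]

theorem flagSolution_blockTriangular (i : Fin m) :
    (D i * flagSolution e p D Y * Y i).BlockTriangular (β i) := by
  intro a b hab
  rw [← flagSystem_mulVec_some e p D Y _ ⟨(i, a, b), hab⟩, flagSystem_mulVec_flagSolution,
    if_neg (by simp)]

end FlagSystem

theorem isOpen_zariskiGL_of_basic {m r : ℕ} {s : Set (Fin m → GL (Fin r) ℂ)}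
    (h : ∀ g ∈ s, ∃ f : MvPolynomial (Fin m × Fin r × Fin r) ℂ,
      MvPolynomial.eval (fun k => (g k.1 : Matrix (Fin r) (Fin r) ℂ) k.2.1 k.2.2) f ≠ 0 ∧
      ∀ g' : Fin m → GL (Fin r) ℂ,
        MvPolynomial.eval (fun k => (g' k.1 : Matrix (Fin r) (Fin r) ℂ) k.2.1 k.2.2) f ≠ 0 →
          g' ∈ s) :
    IsOpen[zariskiGL m r] s := by
  let := zariskiGL m r
  rw [isOpen_iff_forall_mem_open]
  intro g hg
  obtain ⟨f, hf, hfs⟩ := h g hg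
  exact ⟨_, hfs, TopologicalSpace.isOpen_generateFrom_of_mem ⟨f, rfl⟩, hf⟩

/-- If the partial flags given by the columns of `x i`, with block structure `β i`, have only scalar
endomorphisms, and if the number of conditions on such an endomorphism is `r² - 1`, then the
configurations of flags isomorphic to the given one form a Zariski open set. Near such a
configuration, the solution of the system by maximal minors is an isomorphism from the given one
that depends polynomially on the configuration. -/
theorem isOpen_setOf_flags_isomorphic {m r : ℕ} {β : Fin m → Fin r → ℕ}
    {x : Fin m → GL (Fin r) ℂ}
    (hx : ∀ h : Matrix (Fin r) (Fin r) ℂ,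
      (∀ i, (((x i)⁻¹ : GL (Fin r) ℂ) * h * x i : Matrix (Fin r) (Fin r) ℂ).BlockTriangular (β i)) →
        ∃ c : ℂ, h = c • 1)
    (hcard : Fintype.card (BelowBlocks β) + 1 = r * r) :
    IsOpen[zariskiGL m r] {g | ∃ h : GL (Fin r) ℂ, ∀ i,
      (((h * x i)⁻¹ * g i : GL (Fin r) ℂ) : Matrix (Fin r) (Fin r) ℂ).BlockTriangular (β i)} := by
  let e : Fin r × Fin r ≃ Option (BelowBlocks β) := Fintype.equivOfCardEq (by simp [hcard])
  have hr : 0 < r := by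
    rcases Nat.eq_zero_or_pos r with rfl | h
    · simp at hcard
    · exact h
  refine isOpen_zariskiGL_of_basic ?_
  rintro g ⟨h₀, hh₀⟩
  -- every homomorphism from the configuration `x` to the configuration `g` is a multiple of `h₀`
  have hker : ∀ h : Matrix (Fin r) (Fin r) ℂ, (∀ i,
      ((g i : Matrix (Fin r) (Fin r) ℂ).adjugate * h * x i).BlockTriangular (β i)) →
      ∃ c : ℂ, h = c • (h₀ : Matrix (Fin r) (Fin r) ℂ) := by
    intro h hh
    obtain ⟨c, hc⟩ := hx (((h₀⁻¹ : GL (Fin r) ℂ) : Matrix (Fin r) (Fin r) ℂ) * h) (fun i => by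
      have h1 := (hh₀ i).mul (hh i)
      have hadj : (g i : Matrix (Fin r) (Fin r) ℂ) * (g i : Matrix (Fin r) (Fin r) ℂ).adjugate =
          (g i : Matrix (Fin r) (Fin r) ℂ).det • 1 := Matrix.mul_adjugate _
      have h2 : (((h₀ * x i)⁻¹ * g i : GL (Fin r) ℂ) : Matrix (Fin r) (Fin r) ℂ) *
          ((g i : Matrix (Fin r) (Fin r) ℂ).adjugate * h * x i) =
          (g i : Matrix (Fin r) (Fin r) ℂ).det • (((x i)⁻¹ : GL (Fin r) ℂ) *
            (((h₀⁻¹ : GL (Fin r) ℂ) : Matrix (Fin r) (Fin r) ℂ) * h) * x i) := by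
        calc _ = (((h₀ * x i)⁻¹ : GL (Fin r) ℂ) : Matrix (Fin r) (Fin r) ℂ) *
              ((g i : Matrix (Fin r) (Fin r) ℂ) * (g i : Matrix (Fin r) (Fin r) ℂ).adjugate) *
              h * x i := by rw [Units.val_mul]; simp only [mul_assoc]
          _ = _ := by
            rw [hadj, mul_inv_rev, Units.val_mul]
            simp only [Matrix.mul_smul, Matrix.smul_mul, mul_one, mul_assoc]
      intro a b hab
      have h3 := h1 hab
      rw [h2, Matrix.smul_apply, smul_eq_zero] at h3
      exact h3.resolve_left (Matrix.GeneralLinearGroup.det_ne_zero (g i)))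
    refine ⟨c, ?_⟩
    calc h = (h₀ : Matrix (Fin r) (Fin r) ℂ) *
        (((h₀⁻¹ : GL (Fin r) ℂ) : Matrix (Fin r) (Fin r) ℂ) * h) := by
          rw [← mul_assoc, Units.mul_inv, one_mul]
      _ = _ := by rw [hc]; simp
  have : ∃ p : Fin r × Fin r, (h₀ : Matrix (Fin r) (Fin r) ℂ) p.1 p.2 ≠ 0 := by
    by_contra! hcon
    have : Nonempty (Fin r) := ⟨⟨0, hr⟩⟩
    exact h₀.ne_zero (Matrix.ext fun a b => hcon (a, b))
  obtain ⟨p, hp⟩ := this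
  let X : Fin m → Matrix (Fin r) (Fin r) (MvPolynomial (Fin m × Fin r × Fin r) ℂ) :=
    fun i => Matrix.of fun a b => MvPolynomial.X (i, a, b)
  let f : MvPolynomial (Fin m × Fin r × Fin r) ℂ :=
    (flagSolution e p (fun i => (X i).adjugate) (fun i => (x i).1.map MvPolynomial.C)).det
  have hf : ∀ g' : Fin m → GL (Fin r) ℂ,
      MvPolynomial.eval (fun k => (g' k.1 : Matrix (Fin r) (Fin r) ℂ) k.2.1 k.2.2) f =
        (flagSolution e p (fun i => (g' i : Matrix (Fin r) (Fin r) ℂ).adjugate)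
          (fun i => (x i).1)).det := by
    intro g'
    rw [RingHom.map_det, RingHom.mapMatrix_apply, flagSolution_map]
    congr 2
    · funext i
      rw [← RingHom.mapMatrix_apply, RingHom.map_adjugate]
      congr 1
      ext a b
      simp [X]
    · funext i
      ext a b
      simp
  refine ⟨f, ?_, fun g' hg' => ?_⟩
  · rw [hf]
    set D := fun i => (g i : Matrix (Fin r) (Fin r) ℂ).adjugate with hD
    set Y := fun i => (x i).1 with hY
    obtain ⟨c, hc⟩ := hker (flagSolution e p D Y) (flagSolution_blockTriangular e p D Y)
    -- the square system is injective, so its determinant does not vanish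
    have hdet : (flagSystem e p D Y).det ≠ 0 := by
      intro h0
      obtain ⟨v, hv0, hv⟩ := Matrix.exists_mulVec_eq_zero_iff.2 h0
      obtain ⟨c, hc⟩ := hker (Matrix.of fun a b => v (a, b)) (fun i a b hab => by
        have := flagSystem_mulVec_some e p D Y (Matrix.of fun a b => v (a, b)) ⟨(i, a, b), hab⟩
        rw [← this]
        exact congrFun hv _)
      have h1 := flagSystem_mulVec_none e p D Y (Matrix.of fun a b => v (a, b))
      have h2 : v p = 0 := by
        have : (flagSystem e p D Y).mulVec v (e.symm none) = v p := h1
        rw [← this, hv]; rfl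
      have h3 : v p = c * (h₀ : Matrix (Fin r) (Fin r) ℂ) p.1 p.2 :=
        congrFun (congrFun hc p.1) p.2
      have hc0 : c = 0 := by
        rw [h2] at h3
        exact (mul_eq_zero.1 h3.symm).resolve_right hp
      apply hv0
      funext q
      have := congrFun (congrFun hc q.1) q.2
      simpa [hc0] using this
    have hc0 : c ≠ 0 := by
      rintro rfl
      apply hdet
      rw [← flagSolution_apply_self, hc]
      simp
    rw [hc, Matrix.det_smul]
    exact mul_ne_zero (pow_ne_zero _ hc0) (Matrix.GeneralLinearGroup.det_ne_zero h₀)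
  · rw [hf] at hg'
    refine ⟨Matrix.GeneralLinearGroup.mkOfDetNeZero _ hg', fun i => ?_⟩
    set h := Matrix.GeneralLinearGroup.mkOfDetNeZero _ hg' with hh
    have h1 := flagSolution_blockTriangular e p
      (fun i => (g' i : Matrix (Fin r) (Fin r) ℂ).adjugate) (fun i => (x i).1) i
    have h2 : (((g' i)⁻¹ * (h * x i) : GL (Fin r) ℂ) : Matrix (Fin r) (Fin r) ℂ).BlockTriangular
        (β i) := by
      have hadj : (((g' i)⁻¹ : GL (Fin r) ℂ) : Matrix (Fin r) (Fin r) ℂ) =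
          (g' i : Matrix (Fin r) (Fin r) ℂ).det⁻¹ • (g' i : Matrix (Fin r) (Fin r) ℂ).adjugate := by
        rw [Matrix.coe_units_inv, Matrix.inv_def, Ring.inverse_eq_inv']
      rw [Units.val_mul, hadj, Units.val_mul, Matrix.smul_mul, ← mul_assoc]
      exact (Matrix.blockTriangularSubalgebra ℂ ℂ (β i)).smul_mem h1 _
    have := Matrix.GeneralLinearGroup.blockTriangular_inv h2
    rwa [mul_inv_rev, inv_inv] at this

/-! ### Rigid flags for the highest roots -/

theorem revMatrix_mul_revMatrix (k : ℕ) :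
    (Matrix.of fun a b : Fin k => if b = a.rev then 1 else 0 : Matrix (Fin k) (Fin k) ℂ) *
      (Matrix.of fun a b => if a = b.rev then 1 else 0) = 1 := by
  ext a b
  simp [Matrix.mul_apply, Matrix.one_apply, eq_comm]

/-- The permutation matrix of the reversal of `Fin k`. -/
def revGL (k : ℕ) : GL (Fin k) ℂ where
  val := Matrix.of fun a b => if a = b.rev then 1 else 0
  inv := Matrix.of fun a b => if b = a.rev then 1 else 0
  val_inv := mul_eq_one_comm.1 (revMatrix_mul_revMatrix k)
  inv_val := revMatrix_mul_revMatrix k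

theorem revGL_conj_apply {k : ℕ} (h : Matrix (Fin k) (Fin k) ℂ) (a b : Fin k) :
    (((revGL k)⁻¹ : GL (Fin k) ℂ) * h * revGL k : Matrix (Fin k) (Fin k) ℂ) a b =
      h a.rev b.rev := by
  change ((revGL k).2 * h * (revGL k).1) a b = _
  simp [revGL, Matrix.mul_apply]

theorem apply_eq_zero_of_revGL_conj {k : ℕ} {h : Matrix (Fin k) (Fin k) ℂ} {γ : Fin k → ℕ}
    (hh : (((revGL k)⁻¹ : GL (Fin k) ℂ) * h * revGL k : Matrix (Fin k) (Fin k) ℂ).BlockTriangular γ)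
    {a b : Fin k} (hab : γ b.rev < γ a.rev) : h a b = 0 := by
  have := hh hab
  rwa [revGL_conj_apply, Fin.rev_rev, Fin.rev_rev] at this

theorem apply_eq_zero_of_one_conj {k : ℕ} {h : Matrix (Fin k) (Fin k) ℂ} {γ : Fin k → ℕ}
    (hh : (((1 : GL (Fin k) ℂ)⁻¹ : GL (Fin k) ℂ) * h * (1 : GL (Fin k) ℂ) :
      Matrix (Fin k) (Fin k) ℂ).BlockTriangular γ)
    {a b : Fin k} (hab : γ b < γ a) : h a b = 0 := by
  simpa using hh hab

/-- Three distinct lines in `ℂ²`; the fourth flag is trivial. -/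
theorem exists_rigid_flags_D4 : ∃ f : Fin 4 → GL (Fin 2) ℂ, ∀ h : Matrix (Fin 2) (Fin 2) ℂ,
    (∀ i, i ≠ 3 → (((f i)⁻¹ : GL (Fin 2) ℂ) * h * f i : Matrix (Fin 2) (Fin 2) ℂ).BlockTriangular
      fun q => (q : ℕ)) → ∃ c : ℂ, h = c • 1 := by
  let F : Matrix (Fin 2) (Fin 2) ℂ := !![1, 0; 1, 1]
  let F' : Matrix (Fin 2) (Fin 2) ℂ := !![1, 0; -1, 1]
  let u : GL (Fin 2) ℂ := ⟨F, F', by simp [F, F', Matrix.one_fin_two],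
    by simp [F, F', Matrix.one_fin_two]⟩
  refine ⟨![1, revGL 2, u, 1], fun h hh => ⟨h 0 0, ?_⟩⟩
  have h0 : h 1 0 = 0 := apply_eq_zero_of_one_conj (hh 0 (by decide)) (show 0 < 1 by decide)
  have h1 : h 0 1 = 0 := apply_eq_zero_of_revGL_conj (hh 1 (by decide)) (show 0 < 1 by decide)
  have h2 : (F' * h * F) 1 0 = 0 := hh 2 (by decide) (show 0 < 1 by decide)
  have h0' : h 1 0 = 0 := by simpa using h0
  have h1' : h 0 1 = 0 := h1
  simp only [F, F', Matrix.mul_apply, Fin.sum_univ_two, Matrix.of_apply, Matrix.cons_val, h0, h1]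
    at h2
  ext i j
  fin_cases i <;> fin_cases j <;> simp [h0, h1]
  linear_combination h2

/-- Two opposite complete flags in `ℂ³` and the plane `x + y + z = 0`. -/
theorem exists_rigid_flags_E6 : ∃ f : Fin 3 → GL (Fin 3) ℂ, ∀ h : Matrix (Fin 3) (Fin 3) ℂ,
    (∀ i, (((f i)⁻¹ : GL (Fin 3) ℂ) * h * f i : Matrix (Fin 3) (Fin 3) ℂ).BlockTriangular
      fun q => if i = 2 then max 1 (q : ℕ) else q) → ∃ c : ℂ, h = c • 1 := by
  let F : Matrix (Fin 3) (Fin 3) ℂ := !![1, 0, 0; -1, 1, 0; 0, -1, 1]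
  let F' : Matrix (Fin 3) (Fin 3) ℂ := !![1, 0, 0; 1, 1, 0; 1, 1, 1]
  let u : GL (Fin 3) ℂ := ⟨F, F', by simp [F, F', Matrix.one_fin_three],
    by simp [F, F', Matrix.one_fin_three]⟩
  refine ⟨![1, revGL 3, u], fun h hh => ⟨h 0 0, ?_⟩⟩
  have h0 : ∀ a b : Fin 3, b < a → h a b = 0 := fun a b hab =>
    apply_eq_zero_of_one_conj (hh 0) hab
  have h1 : ∀ a b : Fin 3, a < b → h a b = 0 := fun a b hab =>
    apply_eq_zero_of_revGL_conj (hh 1) (Fin.rev_lt_rev.2 hab)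
  have z : ∀ a b : Fin 3, a ≠ b → h a b = 0 := fun a b hab =>
    (lt_or_gt_of_ne hab).elim (h1 a b) (h0 a b)
  have h2 : ∀ a b : Fin 3, max 1 (b : ℕ) < max 1 (a : ℕ) → (F' * h * F) a b = 0 :=
    fun a b hab => hh 2 hab
  have e1 := h2 2 0 (by decide)
  have e2 := h2 2 1 (by decide)
  simp [F, F', Matrix.mul_apply, Fin.sum_univ_three, z, -Matrix.cons_mul] at e1 e2
  ext i j
  by_cases hij : i = j
  · subst hij
    fin_cases i <;> simp
    · linear_combination -e1
    · linear_combination -e1 - e2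
  · simp [z i j hij, hij]

/-- The plane spanned by `e₀ + e₃` and `e₁ + e₂ + e₃`, the standard flag, and the opposite flag
without its line, in `ℂ⁴`. -/
theorem exists_rigid_flags_E7 : ∃ f : Fin 3 → GL (Fin 4) ℂ, ∀ h : Matrix (Fin 4) (Fin 4) ℂ,
    (∀ i, (((f i)⁻¹ : GL (Fin 4) ℂ) * h * f i : Matrix (Fin 4) (Fin 4) ℂ).BlockTriangular
      fun q => if i = 2 then max 1 (q : ℕ) else q / ![2, 1, 1] i) → ∃ c : ℂ, h = c • 1 := by
  let F : Matrix (Fin 4) (Fin 4) ℂ := !![1, 0, 0, 0; 0, 1, 0, 0; 0, 1, 1, 0; 1, 1, 0, 1]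
  let F' : Matrix (Fin 4) (Fin 4) ℂ := !![1, 0, 0, 0; 0, 1, 0, 0; 0, -1, 1, 0; -1, -1, 0, 1]
  have hF : F' * F = 1 := by
    ext i j
    fin_cases i <;> fin_cases j <;>
      simp [F, F', Matrix.mul_apply, Fin.sum_univ_four, -Matrix.cons_mul]
  let u : GL (Fin 4) ℂ := ⟨F, F', mul_eq_one_comm.1 hF, hF⟩
  refine ⟨![u, 1, revGL 4], fun h hh => ⟨h 0 0, ?_⟩⟩
  have h1 : ∀ a b : Fin 4, b < a → h a b = 0 := fun a b hab =>
    apply_eq_zero_of_one_conj (hh 1) (show (b : ℕ) / 1 < a / 1 by simpa using hab)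
  have h2 : ∀ a b : Fin 4, max 1 (b.rev : ℕ) < max 1 (a.rev : ℕ) → h a b = 0 := fun a b hab =>
    apply_eq_zero_of_revGL_conj (hh 2) hab
  -- the entries that survive the two coordinate flags: the diagonal and `(2, 3)`
  have z : ∀ a b : Fin 4, a ≠ b → (a, b) ≠ (2, 3) → h a b = 0 := by
    intro a b hab h23
    have : b < a ∨ max 1 (b.rev : ℕ) < max 1 (a.rev : ℕ) := by
      revert a b; decide
    exact this.elim (h1 a b) (h2 a b)
  have h0 : ∀ a b : Fin 4, (b : ℕ) / 2 < (a : ℕ) / 2 → (F' * h * F) a b = 0 :=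
    fun a b hab => hh 0 hab
  have e1 := h0 2 0 (by decide)
  have e2 := h0 2 1 (by decide)
  have e3 := h0 3 0 (by decide)
  have e4 := h0 3 1 (by decide)
  simp [F, F', Matrix.mul_apply, Fin.sum_univ_four, z, -Matrix.cons_mul] at e1 e2 e3 e4
  ext i j
  by_cases hij : i = j
  · subst hij
    fin_cases i <;> simp
    · linear_combination e3 - e4
    · linear_combination e2 - e1 + e3 - e4
    · linear_combination e3
  · by_cases h23 : (i, j) = (2, 3)
    · obtain ⟨rfl, rfl⟩ := Prod.mk.inj h23
      simp [e1]
    · simp [z i j hij h23, hij]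

/-- The subspace spanned by `e₀ + e₂ + e₃`, `e₁ + e₃ + e₄` and `e₃ + e₅`, the subspaces of dimensions
`2, 4` of the opposite flag, and the standard flag without its line, in `ℂ⁶`. -/
theorem exists_rigid_flags_E8 : ∃ f : Fin 3 → GL (Fin 6) ℂ, ∀ h : Matrix (Fin 6) (Fin 6) ℂ,
    (∀ i, (((f i)⁻¹ : GL (Fin 6) ℂ) * h * f i : Matrix (Fin 6) (Fin 6) ℂ).BlockTriangular
      fun q => if i = 2 then max 1 (q : ℕ) else q / ![3, 2, 1] i) → ∃ c : ℂ, h = c • 1 := by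
  let F : Matrix (Fin 6) (Fin 6) ℂ := !![1, 0, 0, 0, 0, 0; 0, 1, 0, 0, 0, 0; 1, 0, 0, 1, 0, 0;
    1, 1, 1, 0, 1, 0; 0, 1, 0, 0, 0, 1; 0, 0, 1, 0, 0, 0]
  let F' : Matrix (Fin 6) (Fin 6) ℂ := !![1, 0, 0, 0, 0, 0; 0, 1, 0, 0, 0, 0; 0, 0, 0, 0, 0, 1;
    -1, 0, 1, 0, 0, 0; -1, -1, 0, 1, 0, -1; 0, -1, 0, 0, 1, 0]
  have hF : F' * F = 1 := by
    ext i j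
    fin_cases i <;> fin_cases j <;>
      simp [F, F', Matrix.mul_apply, Fin.sum_univ_six, -Matrix.cons_mul]
  let u : GL (Fin 6) ℂ := ⟨F, F', mul_eq_one_comm.1 hF, hF⟩
  refine ⟨![u, revGL 6, 1], fun h hh => ⟨h 0 0, ?_⟩⟩
  have h1 : ∀ a b : Fin 6, (b.rev : ℕ) / 2 < (a.rev : ℕ) / 2 → h a b = 0 := fun a b hab =>
    apply_eq_zero_of_revGL_conj (hh 1) hab
  have h2 : ∀ a b : Fin 6, max 1 (b : ℕ) < max 1 (a : ℕ) → h a b = 0 := fun a b hab =>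
    apply_eq_zero_of_one_conj (hh 2) hab
  -- the entries that survive the two coordinate flags: the diagonal and the four listed ones
  have z : ∀ a b : Fin 6, a ≠ b → (a, b) ∉ [((0 : Fin 6), (1 : Fin 6)), (1, 0), (2, 3), (4, 5)] →
      h a b = 0 := by
    intro a b hab hl
    have : (b.rev : ℕ) / 2 < (a.rev : ℕ) / 2 ∨ max 1 (b : ℕ) < max 1 (a : ℕ) := by
      revert a b; decide
    exact this.elim (h1 a b) (h2 a b)
  have h0 : ∀ a b : Fin 6, (b : ℕ) / 3 < (a : ℕ) / 3 → (F' * h * F) a b = 0 :=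
    fun a b hab => hh 0 hab
  have e1 := h0 3 0 (by decide)
  have e2 := h0 3 1 (by decide)
  have e3 := h0 3 2 (by decide)
  have e4 := h0 4 0 (by decide)
  have e5 := h0 4 1 (by decide)
  have e6 := h0 4 2 (by decide)
  have e7 := h0 5 0 (by decide)
  have e8 := h0 5 1 (by decide)
  have e9 := h0 5 2 (by decide)
  simp [F, F', Matrix.mul_apply, Fin.sum_univ_six, z, -Matrix.cons_mul] at e1 e2 e3 e4 e5 e6 e7 e8 e9
  ext i j
  by_cases hij : i = j
  · subst hij
    fin_cases i <;> simp
    · linear_combination e4 - e5 + e7 - e3 + e2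
    · linear_combination e1 - e3
    · linear_combination e4 + e7
    · linear_combination e8 + e4 - e5 + e7 - e3 + e2
    · linear_combination -e6 + e4 + e7
  · by_cases hl : (i, j) ∈ [((0 : Fin 6), (1 : Fin 6)), (1, 0), (2, 3), (4, 5)]
    · have h01 : h 0 1 = 0 := by linear_combination e3 - e2
      simp only [List.mem_cons, List.not_mem_nil, or_false, Prod.mk.injEq] at hl
      rcases hl with ⟨rfl, rfl⟩ | ⟨rfl, rfl⟩ | ⟨rfl, rfl⟩ | ⟨rfl, rfl⟩ <;> simp [h01, e3, e7, e9]
    · simp [z i j hij hl, hij]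

/-- The block structure on `Fin ℓ` of the `i`-th flag in the case `n = 1`: blocks of equal length
`ℓ / d_i`, except that the first two of the `ℓ` blocks of the last flag are merged. -/
def StarType.tipBlock (T : StarType) (i : Fin T.m) (q : ℕ) : ℕ :=
  if i = T.last then max 1 q else q / (T.ell / T.d i)

/-- Rigid flags in the case `n = 1`: an indecomposable representation whose dimension vector is the
highest root of the finite Dynkin diagram. -/
theorem StarType.exists_rigid_flags (T : StarType) : ∃ f : Fin T.m → GL (Fin T.ell) ℂ,
    ∀ h : Matrix (Fin T.ell) (Fin T.ell) ℂ,
    (∀ i, (((f i)⁻¹ : GL (Fin T.ell) ℂ) * h * f i :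
      Matrix (Fin T.ell) (Fin T.ell) ℂ).BlockTriangular fun q => T.tipBlock i q) →
        ∃ c : ℂ, h = c • 1 := by
  cases T
  · obtain ⟨f, hf⟩ := exists_rigid_flags_D4
    have key : ∀ i : Fin 4, i ≠ 3 → ∀ q : Fin 2, D4.tipBlock i q = q := by decide
    exact ⟨f, fun h hh => hf h fun i hi a b hab => hh i
      (show D4.tipBlock i b < D4.tipBlock i a from by rwa [key i hi, key i hi])⟩
  · obtain ⟨f, hf⟩ := exists_rigid_flags_E6
    have key : ∀ i : Fin 3, ∀ q : Fin 3,
      E6.tipBlock i q = if i = 2 then max 1 (q : ℕ) else q := by decide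
    exact ⟨f, fun h hh => hf h fun i a b hab => hh i
      (show E6.tipBlock i b < E6.tipBlock i a from by rwa [key i, key i])⟩
  · obtain ⟨f, hf⟩ := exists_rigid_flags_E7
    have key : ∀ i : Fin 3, ∀ q : Fin 4,
      E7.tipBlock i q = if i = 2 then max 1 (q : ℕ) else q / ![2, 1, 1] i := by decide
    exact ⟨f, fun h hh => hf h fun i a b hab => hh i
      (show E7.tipBlock i b < E7.tipBlock i a from by rwa [key i, key i])⟩
  · obtain ⟨f, hf⟩ := exists_rigid_flags_E8
    have key : ∀ i : Fin 3, ∀ q : Fin 6,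
      E8.tipBlock i q = if i = 2 then max 1 (q : ℕ) else q / ![3, 2, 1] i := by decide
    exact ⟨f, fun h hh => hf h fun i a b hab => hh i
      (show E8.tipBlock i b < E8.tipBlock i a from by rwa [key i, key i])⟩

/-! ### Tensoring with a Kronecker module -/

theorem exists_eq_smul_one_of_toeplitz {n : ℕ} {A : Matrix (Fin n) (Fin n) ℂ}
    (hA : ∀ u s v t : Fin n, (v : ℕ) = u + 1 → (t : ℕ) = s + 1 → A v t = A u s)
    (hfirst : ∀ v t : Fin n, (v : ℕ) = 0 → 0 < (t : ℕ) → A v t = 0)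
    (hlast : ∀ u s : Fin n, (u : ℕ) + 1 = n → (s : ℕ) + 1 < n → A u s = 0) :
    ∃ c : ℂ, A = c • 1 := by
  rcases Nat.eq_zero_or_pos n with rfl | hn
  · exact ⟨0, by ext i; exact i.elim0⟩
  have up : ∀ k : ℕ, ∀ u s : Fin n, (u : ℕ) = k → u < s → A u s = 0 := by
    intro k
    induction k with
    | zero => exact fun u s hu hus => hfirst u s hu (hu ▸ hus)
    | succ k ih =>
      intro u s hu hus
      have hus' : (u : ℕ) < s := hus
      rw [hA ⟨k, by omega⟩ ⟨s - 1, by omega⟩ u s hu (by simp; omega)]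
      exact ih _ _ rfl (by rw [Fin.lt_def]; simp; omega)
  have low : ∀ k : ℕ, ∀ u s : Fin n, (u : ℕ) + k + 1 = n → s < u → A u s = 0 := by
    intro k
    induction k with
    | zero =>
      intro u s hu hsu
      have hsu' : (s : ℕ) < u := hsu
      exact hlast u s hu (by omega)
    | succ k ih =>
      intro u s hu hsu
      have hsu' : (s : ℕ) < u := hsu
      rw [← hA u s ⟨u + 1, by omega⟩ ⟨s + 1, by omega⟩ rfl rfl]
      exact ih _ _ (by simp; omega) (by rw [Fin.lt_def]; simp; omega)
  have diag : ∀ k : ℕ, ∀ u : Fin n, (u : ℕ) = k → A u u = A ⟨0, hn⟩ ⟨0, hn⟩ := by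
    intro k
    induction k with
    | zero => intro u hu; rw [show u = ⟨0, hn⟩ from Fin.ext hu]
    | succ k ih =>
      intro u hu
      rw [hA ⟨k, by omega⟩ ⟨k, by omega⟩ u u hu hu]
      exact ih _ rfl
  refine ⟨A ⟨0, hn⟩ ⟨0, hn⟩, ?_⟩
  ext u s
  rcases lt_trichotomy u s with h | rfl | h
  · simp [up u u s rfl h, h.ne]
  · simp [diag u u rfl]
  · simp [low (n - 1 - u) u s (by omega) h, h.ne']

open scoped Kronecker

/-- The endomorphism `f ⊗ 1` of `ℂ^ℓ ⊗ ℂ^n`. -/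
def kroneckerOneGL {ℓ : ℕ} (n : ℕ) (f : GL (Fin ℓ) ℂ) : GL (Fin ℓ × Fin n) ℂ where
  val := f.val ⊗ₖ (1 : Matrix (Fin n) (Fin n) ℂ)
  inv := f.inv ⊗ₖ (1 : Matrix (Fin n) (Fin n) ℂ)
  val_inv := by rw [← Matrix.mul_kronecker_mul]; simp
  inv_val := by rw [← Matrix.mul_kronecker_mul]; simp

/-- The coefficient block of `h ∈ End (ℂ^ℓ ⊗ ℂ^n)` at the matrix unit `E_{st}` of `End ℂ^n`. -/
def kroneckerSlice {ℓ n : ℕ} (h : Matrix (Fin ℓ × Fin n) (Fin ℓ × Fin n) ℂ) (s t : Fin n) :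
    Matrix (Fin ℓ) (Fin ℓ) ℂ :=
  Matrix.of fun q q' => h (q, s) (q', t)

theorem kroneckerSlice_conj {ℓ n : ℕ} (f : GL (Fin ℓ) ℂ)
    (h : Matrix (Fin ℓ × Fin n) (Fin ℓ × Fin n) ℂ) (s t : Fin n) :
    kroneckerSlice (((kroneckerOneGL n f)⁻¹ : GL (Fin ℓ × Fin n) ℂ) * h * kroneckerOneGL n f :
        Matrix (Fin ℓ × Fin n) (Fin ℓ × Fin n) ℂ) s t =
      ((f⁻¹ : GL (Fin ℓ) ℂ) * kroneckerSlice h s t * f : Matrix (Fin ℓ) (Fin ℓ) ℂ) := by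
  change kroneckerSlice ((kroneckerOneGL n f).inv * h * (kroneckerOneGL n f).val) s t =
    f.inv * kroneckerSlice h s t * f.val
  ext q q'
  simp [kroneckerSlice, kroneckerOneGL, Matrix.mul_apply, Matrix.one_apply, Fintype.sum_prod_type]

/-- The nilpotent matrix `e_0 ⊗ e_s ↦ e_1 ⊗ e_{s+1}` on `ℂ^ℓ ⊗ ℂ^n`. -/
def kroneckerShift (ℓ n : ℕ) : Matrix (Fin ℓ × Fin n) (Fin ℓ × Fin n) ℂ :=
  Matrix.of fun a b =>
    if (a.1 : ℕ) = 1 ∧ (b.1 : ℕ) = 0 ∧ (a.2 : ℕ) = b.2 + 1 then 1 else 0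

theorem kroneckerShift_mul_self (ℓ n : ℕ) : kroneckerShift ℓ n * kroneckerShift ℓ n = 0 := by
  ext a b
  rw [Matrix.mul_apply]
  refine Finset.sum_eq_zero fun c _ => ?_
  simp only [kroneckerShift, Matrix.of_apply]
  split_ifs with h1 h2 <;> simp
  omega

/-- The unipotent matrix `1 + N`, `N` the shift `e_0 ⊗ e_s ↦ e_1 ⊗ e_{s+1}`. -/
def kroneckerShiftGL (ℓ n : ℕ) : GL (Fin ℓ × Fin n) ℂ where
  val := 1 + kroneckerShift ℓ n
  inv := 1 - kroneckerShift ℓ n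
  val_inv := by simp [add_mul, mul_sub, kroneckerShift_mul_self]
  inv_val := by simp [sub_mul, mul_add, kroneckerShift_mul_self]

theorem kroneckerShift_blockTriangular (ℓ n : ℕ) :
    (kroneckerShift ℓ n).BlockTriangular fun a => max 1 (a.1 : ℕ) := by
  intro a b hab
  simp only [kroneckerShift, Matrix.of_apply]
  rw [if_neg]
  rintro ⟨h1, h2, -⟩
  simp [h1, h2] at hab

/-- The block structure of the flag with subspaces of dimensions `n - 1, 2n, 3n, …`, in the
basis `e_q ⊗ e_s` ordered lexicographically. -/
def shiftBlock (n q s : ℕ) : ℕ := if q = 0 ∧ s + 1 < n then 0 else max 1 q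

/-- The representation `M ⊗ ℂ^n`, where `M` consists of rigid flags in `ℂ^ℓ`, with one more
subspace of dimension `n - 1`, spanned by the vectors `f_0 ⊗ e_s + f_1 ⊗ e_{s+1}`, has only scalar
endomorphisms: an endomorphism of `M ⊗ ℂ^n` is `1 ⊗ A`, and compatibility with that subspace makes
`A` an endomorphism of a preprojective Kronecker module. -/
theorem exists_rigid_flags_kronecker {ι : Type*} [DecidableEq ι] {ℓ n : ℕ} (hℓ : 2 ≤ ℓ)
    (j : ι) {γ : ι → ℕ → ℕ} (hγ : ∀ q, γ j q = max 1 q) {f : ι → GL (Fin ℓ) ℂ}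
    (hf : ∀ h : Matrix (Fin ℓ) (Fin ℓ) ℂ,
      (∀ i, (((f i)⁻¹ : GL (Fin ℓ) ℂ) * h * f i : Matrix (Fin ℓ) (Fin ℓ) ℂ).BlockTriangular
        fun q => γ i q) → ∃ c : ℂ, h = c • 1) :
    ∃ x : ι → GL (Fin ℓ × Fin n) ℂ, ∀ h : Matrix (Fin ℓ × Fin n) (Fin ℓ × Fin n) ℂ,
      (∀ i, (((x i)⁻¹ : GL (Fin ℓ × Fin n) ℂ) * h * x i :
        Matrix (Fin ℓ × Fin n) (Fin ℓ × Fin n) ℂ).BlockTriangular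
        fun a => if i = j then shiftBlock n a.1 a.2 else γ i a.1) → ∃ c : ℂ, h = c • 1 := by
  refine ⟨fun i => if i = j then kroneckerOneGL n (f j) * kroneckerShiftGL ℓ n
    else kroneckerOneGL n (f i), fun h hh => ?_⟩
  let U := kroneckerShiftGL ℓ n
  have hU : (U : Matrix _ _ ℂ).BlockTriangular fun a : Fin ℓ × Fin n => max 1 (a.1 : ℕ) :=
    Matrix.blockTriangular_one.add (kroneckerShift_blockTriangular ℓ n)
  have hU' : ((U⁻¹ : GL _ ℂ) : Matrix _ _ ℂ).BlockTriangular
      fun a : Fin ℓ × Fin n => max 1 (a.1 : ℕ) :=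
    Matrix.blockTriangular_one.sub (kroneckerShift_blockTriangular ℓ n)
  let h' : Matrix (Fin ℓ × Fin n) (Fin ℓ × Fin n) ℂ :=
    ((kroneckerOneGL n (f j))⁻¹ : GL _ ℂ) * h * kroneckerOneGL n (f j)
  let t : Matrix (Fin ℓ × Fin n) (Fin ℓ × Fin n) ℂ := (U⁻¹ : GL _ ℂ) * h' * U
  have ht : t.BlockTriangular fun a => shiftBlock n a.1 a.2 := by
    have := hh j
    simp only [if_true] at this
    rw [mul_inv_rev, Units.val_mul, Units.val_mul] at this
    simpa only [t, h', mul_assoc] using this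
  have hUt : h' * U = U * t := by
    simp only [t, ← mul_assoc, Units.mul_inv, one_mul]
  have hh' : h'.BlockTriangular fun a => max 1 (a.1 : ℕ) := by
    have e : h' = U * t * (U⁻¹ : GL _ ℂ) := by
      rw [← hUt, mul_assoc, Units.mul_inv, mul_one]
    have ht' : t.BlockTriangular fun a => max 1 (a.1 : ℕ) := by
      intro a b hab
      refine ht ?_
      simp only [shiftBlock] at hab ⊢
      split_ifs <;> omega
    rw [e]
    exact (hU.mul ht').mul hU'
  have hslice : ∀ s s', ∃ c : ℂ, kroneckerSlice h s s' = c • 1 := by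
    intro s s'
    refine hf _ fun i => ?_
    rw [← kroneckerSlice_conj]
    intro q q' hq
    by_cases hi : i = j
    · subst hi
      simp only [hγ] at hq
      exact hh' hq
    · have := hh i
      simp only [if_neg hi] at this
      exact this hq
  choose A hA using hslice
  have hA' : ∀ s s', kroneckerSlice h' s s' = A s s' • 1 := by
    intro s s'
    simp only [h']
    rw [kroneckerSlice_conj, hA]
    simp
  have hentry : ∀ q s q' s', h' (q, s) (q', s') = if q = q' then A s s' else 0 := by
    intro q s q' s'
    have := congrFun (congrFun (hA' s s') q) q'
    simpa [kroneckerSlice, Matrix.one_apply] using this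
  let o : Fin ℓ := ⟨0, by omega⟩
  let w : Fin ℓ := ⟨1, by omega⟩
  have how : o ≠ w := by simp [o, w]
  -- multiplication by `1 + N` on the right adds the column `(1, s + 1)` to the column `(0, s)`
  have hcol : ∀ (a : Fin ℓ × Fin n) (s v : Fin n), (v : ℕ) = s + 1 →
      (h' * U) a (o, s) = h' a (o, s) + h' a (w, v) := by
    intro a s v hv
    change (h' * (1 + kroneckerShift ℓ n)) a (o, s) = _
    rw [mul_add, mul_one, Matrix.add_apply, Matrix.mul_apply, Finset.sum_eq_single (w, v)]
    · simp [kroneckerShift, o, w, hv]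
    · rintro ⟨q, u⟩ - hqu
      have : ¬((q : ℕ) = 1 ∧ (u : ℕ) = s + 1) := fun hc =>
        hqu (Prod.ext (Fin.ext hc.1) (Fin.ext (by simp; omega)))
      simp only [kroneckerShift, Matrix.of_apply]
      rw [if_neg (by tauto), mul_zero]
    · simp
  -- multiplication by `1 + N` on the left adds the row `(0, s)` to the row `(1, s + 1)`
  have hrow0 : ∀ (b : Fin ℓ × Fin n) (s : Fin n), (U * t) (o, s) b = t (o, s) b := by
    intro b s
    change ((1 + kroneckerShift ℓ n) * t) (o, s) b = _
    rw [add_mul, one_mul, Matrix.add_apply, Matrix.mul_apply, Finset.sum_eq_zero, add_zero]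
    simp [kroneckerShift, o]
  have hrow1 : ∀ (b : Fin ℓ × Fin n) (s v : Fin n), (v : ℕ) = s + 1 →
      (U * t) (w, v) b = t (w, v) b + t (o, s) b := by
    intro b s v hv
    change ((1 + kroneckerShift ℓ n) * t) (w, v) b = _
    rw [add_mul, one_mul, Matrix.add_apply, Matrix.mul_apply, Finset.sum_eq_single (o, s)]
    · simp [kroneckerShift, o, w, hv]
    · rintro ⟨q, u⟩ - hqu
      have : ¬((q : ℕ) = 0 ∧ (v : ℕ) = u + 1) := fun hc =>
        hqu (Prod.ext (Fin.ext hc.1) (Fin.ext (by simp; omega)))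
      simp only [kroneckerShift, Matrix.of_apply]
      rw [if_neg (by tauto), zero_mul]
    · simp
  have hrow1' : ∀ (b : Fin ℓ × Fin n) (v : Fin n), (v : ℕ) = 0 → (U * t) (w, v) b = t (w, v) b := by
    intro b v hv
    change ((1 + kroneckerShift ℓ n) * t) (w, v) b = _
    rw [add_mul, one_mul, Matrix.add_apply, Matrix.mul_apply, Finset.sum_eq_zero, add_zero]
    simp [kroneckerShift, w, hv]
  have htw : ∀ s v : Fin n, (s : ℕ) + 1 < n → t (w, v) (o, s) = 0 := fun s v hs => ht (by
    simp [shiftBlock, o, w, hs])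
  have hto : ∀ s v : Fin n, (s : ℕ) + 1 < n → (v : ℕ) + 1 = n → t (o, v) (o, s) = 0 :=
    fun s v hs hv => ht (by simp [shiftBlock, o, hs, hv])
  have hAt : ∀ u s : Fin n, (s : ℕ) + 1 < n → A u s = t (o, u) (o, s) := by
    intro u s hs
    have := hcol (o, u) s ⟨s + 1, hs⟩ rfl
    rw [hUt, hrow0, hentry, hentry, if_pos rfl, if_neg how, add_zero] at this
    exact this.symm
  obtain ⟨c, hc⟩ := exists_eq_smul_one_of_toeplitz (A := Matrix.of A)
    (fun u s v s' hv hs' => by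
      have hs : (s : ℕ) + 1 < n := hs' ▸ s'.2
      have := hcol (w, v) s s' hs'
      rw [hUt, hrow1 _ u v hv, hentry, hentry, if_pos rfl, if_neg how.symm, zero_add, htw s v hs,
        zero_add, ← hAt u s hs] at this
      exact this.symm)
    (fun v s' hv hs' => by
      have hs : ((s' : ℕ) - 1) + 1 < n := by omega
      have := hcol (w, v) ⟨s' - 1, by omega⟩ s' (by simp; omega)
      rw [hUt, hrow1' _ v hv, hentry, hentry, if_pos rfl, if_neg how.symm, zero_add,
        htw _ v hs] at this
      exact this.symm)
    (fun u s hu hs => (hAt u s hs).trans (hto s u hs hu))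
  refine ⟨c, ?_⟩
  ext ⟨q, s⟩ ⟨q', s'⟩
  have h1 := congrFun (congrFun (hA s s') q) q'
  have h2 : A s s' = (c • (1 : Matrix (Fin n) (Fin n) ℂ)) s s' := congrFun (congrFun hc s) s'
  simp only [kroneckerSlice, Matrix.of_apply] at h1
  rw [h1, h2]
  by_cases hq : q = q' <;> by_cases hs : s = s' <;> simp [hq, hs]

namespace StarType

/-! ### The block structures of the parabolic subgroups -/

/-- The block structure of the `i`-th parabolic subgroup of `PGL_{nℓ}`: blocks of equal length
`nℓ / d_i` for `i < m`, and blocks of lengths `n - 1, n + 1, n, …, n` for `i = m`. -/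
def block (T : StarType) (n : ℕ) (i : Fin T.m) (a : ℕ) : ℕ :=
  if i = T.last then (if a + 1 < n then 0 else max 1 (a / n)) else a / (n * (T.ell / T.d i))

theorem d_dvd_ell (T : StarType) (i : Fin T.m) : T.d i ∣ T.ell := by
  cases T <;> revert i <;> decide

theorem two_le_ell (T : StarType) : 2 ≤ T.ell := by cases T <;> decide

theorem block_of_eq_add {T : StarType} {n : ℕ} {i : Fin T.m} {a q s : ℕ} (hs : s < n)
    (ha : a = s + n * q) :
    T.block n i a = if i = T.last then shiftBlock n q s else T.tipBlock i q := by
  have hn : 0 < n := by omega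
  have hdiv : a / n = q := by
    rw [ha, Nat.add_mul_div_left _ _ hn, Nat.div_eq_of_lt hs, zero_add]
  unfold block tipBlock shiftBlock
  split_ifs with h1 h2 h3 h3
  · rfl
  · exfalso
    rcases Nat.eq_zero_or_pos q with rfl | hq
    · simp at ha; omega
    · have := Nat.le_mul_of_pos_right n hq
      omega
  · exfalso
    obtain ⟨rfl, h4⟩ := h3
    simp at ha; omega
  · rw [hdiv]
  · rw [← Nat.div_div_eq_div_mul, hdiv]

theorem block_monotone (T : StarType) (n : ℕ) (i : Fin T.m) : Monotone (T.block n i) := by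
  intro a b hab
  unfold block
  have h1 : a / n ≤ b / n := Nat.div_le_div_right hab
  split_ifs
  · exact le_rfl
  · exact Nat.zero_le _
  · omega
  · exact max_le_max le_rfl h1
  · exact Nat.div_le_div_right hab

theorem block_succ_eq_iff_of_ne {T : StarType} {n : ℕ} {i : Fin T.m} (hi : i ≠ T.last) (a : ℕ) :
    T.block n i (a + 1) = T.block n i a ↔ ¬ n * (T.ell / T.d i) ∣ a + 1 := by
  simp only [block, if_neg hi, Nat.succ_div]
  split_ifs with h <;> simp [h]

theorem block_last_succ_eq_iff {T : StarType} {n : ℕ} (hn : 1 ≤ n) (a : ℕ) :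
    T.block n T.last (a + 1) = T.block n T.last a ↔
      (a + 1 ≠ n - 1 ∧ ¬ n ∣ a + 1) ∨ a + 1 = n := by
  simp only [block, if_true]
  rcases lt_trichotomy (a + 1) n with h | h | h
  · have hnd : ¬ n ∣ a + 1 := fun hd => by
      have := Nat.le_of_dvd (Nat.succ_pos a) hd
      omega
    simp only [hnd, h, if_true, not_false_eq_true, and_true]
    by_cases h2 : a + 1 + 1 < n
    · simp [h2]; omega
    · rw [if_neg h2]; omega
  · have h1 : (a + 1) / n = 1 := by rw [h]; exact Nat.div_self hn
    have h2 : a / n = 0 := Nat.div_eq_of_lt (by omega)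
    rw [if_neg (by omega), if_neg (by omega), h1, h2]
    simp [h]
  · have h1 : 1 ≤ a / n := (Nat.one_le_div_iff hn).2 (by omega)
    rw [if_neg (by omega), if_neg (by omega), Nat.succ_div]
    split_ifs with hd
    · simp [hd]; omega
    · simp [hd]; omega

theorem parabolic_eq (T : StarType) {n : ℕ} (hn : 1 ≤ n) (i : Fin T.m) :
    T.parabolic n i = groupOfLieAlg (slBlockTriangular fun a => T.block n i a) := by
  unfold parabolic
  have hpos : 0 < T.ell := (Nat.zero_lt_two).trans_le T.two_le_ell
  split_ifs with hi
  · subst hi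
    congr 1
    have hdiv : n * T.ell / T.ell = n := Nat.mul_div_cancel n hpos
    have e : parabolicAlgTilde'' T.ell (n * T.ell) = LieSubalgebra.lieSpan ℂ _
        (upperTriangularSl (n * T.ell) ∪ lowerGenerators (n * T.ell)
          {i | (i ≠ n - 1 ∧ ¬ n ∣ i) ∨ i = n}) := by
      unfold parabolicAlgTilde'' parabolicAlg''
      rw [hdiv, LieSubalgebra.span_union, LieSubalgebra.lieSpan_eq, ← LieSubalgebra.span_union,
        Set.union_assoc]
      congr 2
      ext x
      constructor
      · rintro (⟨a, b, h1, h2, h3⟩ | ⟨a, b, h1, h2, h3⟩)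
        · exact ⟨a, b, h1, Or.inl h2, h3⟩
        · exact ⟨a, b, h1, Or.inr h2, h3⟩
      · rintro ⟨a, b, h1, h2 | h2, h3⟩
        · exact Or.inl ⟨a, b, h1, h2, h3⟩
        · exact Or.inr ⟨a, b, h1, h2, h3⟩
    rw [e]
    exact lieSpan_lowerGenerators (T.block_monotone n _) fun a _ => (block_last_succ_eq_iff hn a).symm
  · congr 1
    have hdiv : n * T.ell / T.d i = n * (T.ell / T.d i) := Nat.mul_div_assoc n (T.d_dvd_ell i)
    unfold parabolicAlg
    rw [hdiv]
    exact lieSpan_lowerGenerators (T.block_monotone n _)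
      fun a _ => (block_succ_eq_iff_of_ne hi a).symm

/-! ### The dimension of `X` -/

/-- The bijection from pairs `(q, s)` to `s + nq`. -/
def indexEquiv (T : StarType) (n : ℕ) : Fin T.ell × Fin n ≃ Fin (n * T.ell) :=
  finProdFinEquiv.trans (finCongr (mul_comm _ _))

theorem block_indexEquiv (T : StarType) (n : ℕ) (i : Fin T.m) (a : Fin T.ell × Fin n) :
    T.block n i (T.indexEquiv n a) =
      if i = T.last then shiftBlock n a.1 a.2 else T.tipBlock i a.1 :=
  block_of_eq_add a.2.2 rfl

/-- For `n = 1` the variety `X` has dimension `ℓ² - 1`. -/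
theorem sum_tipBlock_lt (T : StarType) :
    (∑ i : Fin T.m, ∑ q : Fin T.ell, ∑ q' : Fin T.ell,
      if T.tipBlock i q' < T.tipBlock i q then 1 else 0) + 1 = T.ell * T.ell := by
  cases T <;> decide +kernel

theorem sum_fin_succ_lt (n : ℕ) : (∑ s : Fin n, if (s : ℕ) + 1 < n then 1 else 0) = n - 1 := by
  rw [Fin.sum_univ_eq_sum_range (fun s => if s + 1 < n then 1 else 0)]
  cases n with
  | zero => rfl
  | succ k =>
    rw [Finset.sum_range_succ, Finset.sum_congr rfl (g := fun _ => 1)]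
    · simp
    · intro s hs
      rw [Finset.mem_range] at hs
      simp [hs]

theorem sum_sum_fst (ℓ n : ℕ) (F : Fin ℓ → Fin ℓ → ℕ) :
    ∑ a : Fin ℓ × Fin n, ∑ b : Fin ℓ × Fin n, F a.1 b.1 = n * n * ∑ q, ∑ q', F q q' := by
  simp only [Fintype.sum_prod_type, Finset.sum_const, Finset.card_univ, Fintype.card_fin,
    smul_eq_mul, ← Finset.mul_sum, mul_assoc]

theorem sum_fst_mul_snd (ℓ n : ℕ) (F : Fin ℓ → ℕ) (G : Fin n → ℕ) :
    ∑ a : Fin ℓ × Fin n, F a.1 * G a.2 = (∑ q, F q) * ∑ s, G s := by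
  rw [Fintype.sum_prod_type, Finset.sum_mul_sum]

theorem sum_shiftBlock_lt (T : StarType) {n : ℕ} (hn : 1 ≤ n) :
    (∑ a : Fin T.ell × Fin n, ∑ b : Fin T.ell × Fin n,
      if shiftBlock n b.1 b.2 < shiftBlock n a.1 a.2 then 1 else 0) + 1 =
    n * n * (∑ q : Fin T.ell, ∑ q' : Fin T.ell,
      if max 1 (q' : ℕ) < max 1 (q : ℕ) then 1 else 0) + n * n := by
  let u : Fin T.ell × Fin n → ℕ := fun b => if (b.1 : ℕ) = 0 ∧ (b.2 : ℕ) + 1 < n then 1 else 0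
  let v : Fin T.ell × Fin n → ℕ := fun a =>
    if (a.1 : ℕ) ≤ 1 ∧ ¬((a.1 : ℕ) = 0 ∧ (a.2 : ℕ) + 1 < n) then 1 else 0
  have hsplit : ∀ a b : Fin T.ell × Fin n,
      (if shiftBlock n b.1 b.2 < shiftBlock n a.1 a.2 then 1 else 0) =
        (if max 1 (b.1 : ℕ) < max 1 (a.1 : ℕ) then 1 else 0) + v a * u b := by
    intro a b
    simp only [shiftBlock, u, v]
    split_ifs <;> omega
  have hℓ0 : (∑ q : Fin T.ell, if (q : ℕ) = 0 then 1 else 0) = 1 := by cases T <;> rfl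
  have hℓ1 : (∑ q : Fin T.ell, if (q : ℕ) ≤ 1 then 1 else 0) = 2 := by cases T <;> rfl
  have hu : ∑ b, u b = n - 1 := by
    have : ∀ b : Fin T.ell × Fin n, u b =
        (if (b.1 : ℕ) = 0 then 1 else 0) * (if (b.2 : ℕ) + 1 < n then 1 else 0) := by
      intro b; simp only [u]; split_ifs <;> simp_all
    rw [Finset.sum_congr rfl fun b _ => this b]
    refine (sum_fst_mul_snd T.ell n (fun q => if (q : ℕ) = 0 then 1 else 0)
      fun s => if (s : ℕ) + 1 < n then 1 else 0).trans ?_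
    rw [sum_fin_succ_lt, hℓ0, one_mul]
  have hv : ∑ a, v a + (n - 1) = 2 * n := by
    rw [← hu, ← Finset.sum_add_distrib]
    have : ∀ a : Fin T.ell × Fin n, v a + u a = (if (a.1 : ℕ) ≤ 1 then 1 else 0) * 1 := by
      intro b; simp only [u, v]; split_ifs <;> omega
    rw [Finset.sum_congr rfl fun a _ => this a]
    refine (sum_fst_mul_snd T.ell n (fun q => if (q : ℕ) ≤ 1 then 1 else 0) fun _ => 1).trans ?_
    rw [hℓ1]; simp
  have hv' : ∑ a, v a = n + 1 := by omega
  simp only [hsplit, Finset.sum_add_distrib, ← Finset.mul_sum, ← Finset.sum_mul, hu, hv']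
  have h := sum_sum_fst T.ell n fun q q' => if max 1 (q' : ℕ) < max 1 (q : ℕ) then 1 else 0
  have hsq : (n + 1) * (n - 1) + 1 = n * n := by
    obtain ⟨k, rfl⟩ : ∃ k, n = k + 1 := ⟨n - 1, by omega⟩
    simp only [Nat.add_sub_cancel]
    ring
  rw [add_assoc, hsq]
  exact congrArg (· + n * n) h
/-- The variety `X` has the dimension `(nℓ)² - 1` of the group. -/
theorem card_belowBlocks (T : StarType) {n : ℕ} (hn : 1 ≤ n) :
    Fintype.card (BelowBlocks fun (i : Fin T.m) (a : Fin (n * T.ell)) => T.block n i a) + 1 =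
      n * T.ell * (n * T.ell) := by
  have h1 : Fintype.card (BelowBlocks fun (i : Fin T.m) (a : Fin (n * T.ell)) => T.block n i a) =
      ∑ i : Fin T.m, ∑ a : Fin T.ell × Fin n, ∑ b : Fin T.ell × Fin n,
        if T.block n i (T.indexEquiv n b) < T.block n i (T.indexEquiv n a) then 1 else 0 := by
    rw [Fintype.card_subtype, Finset.card_filter, Fintype.sum_prod_type]
    refine Finset.sum_congr rfl fun i _ => ?_
    rw [Fintype.sum_prod_type, ← Equiv.sum_comp (T.indexEquiv n)]
    exact Finset.sum_congr rfl fun a _ => by rw [← Equiv.sum_comp (T.indexEquiv n)]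
  have h2 : ∀ i : Fin T.m, (∑ a : Fin T.ell × Fin n, ∑ b : Fin T.ell × Fin n,
      if T.block n i (T.indexEquiv n b) < T.block n i (T.indexEquiv n a) then 1 else 0) +
        (if i = T.last then 1 else 0) =
      n * n * (∑ q : Fin T.ell, ∑ q' : Fin T.ell,
        if T.tipBlock i q' < T.tipBlock i q then 1 else 0) + if i = T.last then n * n else 0 := by
    intro i
    simp only [block_indexEquiv]
    by_cases hi : i = T.last
    · simp only [hi, if_true, tipBlock]
      exact T.sum_shiftBlock_lt hn
    · simp only [hi, if_false, add_zero]
      exact sum_sum_fst T.ell n fun q q' => if T.tipBlock i q' < T.tipBlock i q then 1 else 0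
  have h3 := Finset.sum_congr rfl fun i (_ : i ∈ Finset.univ) => h2 i
  simp only [Finset.sum_add_distrib, Finset.sum_ite_eq', Finset.mem_univ, if_true,
    ← Finset.mul_sum] at h3
  rw [h1, h3]
  have h4 := T.sum_tipBlock_lt
  calc _ = n * n * ((∑ i : Fin T.m, ∑ q : Fin T.ell, ∑ q' : Fin T.ell,
      if T.tipBlock i q' < T.tipBlock i q then 1 else 0) + 1) := by ring
    _ = _ := by rw [h4]; ring

/-! ### The open orbit -/

/-- Rigid flags of the type of `X`: their only endomorphisms are the scalars. -/
theorem exists_rigid_point (T : StarType) (n : ℕ) : ∃ x : Fin T.m → GL (Fin (n * T.ell)) ℂ,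
    ∀ h : Matrix (Fin (n * T.ell)) (Fin (n * T.ell)) ℂ,
      (∀ i, (((x i)⁻¹ : GL (Fin (n * T.ell)) ℂ) * h * x i :
        Matrix (Fin (n * T.ell)) (Fin (n * T.ell)) ℂ).BlockTriangular fun a => T.block n i a) →
          ∃ c : ℂ, h = c • 1 := by
  obtain ⟨f, hf⟩ := T.exists_rigid_flags
  obtain ⟨x, hx⟩ := exists_rigid_flags_kronecker (n := n) T.two_le_ell T.last (γ := T.tipBlock)
    (fun q => by simp [tipBlock]) hf
  let φ := Matrix.reindexAlgEquiv ℂ ℂ (T.indexEquiv n)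
  refine ⟨fun i => Units.map (φ : _ →* _) (x i), fun h hh => ?_⟩
  obtain ⟨h, rfl⟩ := φ.surjective h
  obtain ⟨c, hc⟩ := hx h (fun i a b hab => by
    have hφ : φ (((x i)⁻¹ : GL (Fin T.ell × Fin n) ℂ) * h * x i)
        (T.indexEquiv n a) (T.indexEquiv n b) = 0 := by
      rw [map_mul, map_mul]
      refine hh i ?_
      simpa only [block_indexEquiv] using hab
    simpa [φ] using hφ)
  exact ⟨c, by rw [hc]; simp⟩

end StarType

theorem lemma3 (T : StarType) (n : ℕ) (hn : 1 ≤ n) :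
    ∃ x : T.X n,
      IsOpen[zariskiProd (T.parabolic n)] (MulAction.orbit (PGL (n * T.ell)) x) ∧
      ∀ y ∈ MulAction.orbit (PGL (n * T.ell)) x,
        ∀ g : PGL (n * T.ell), g • y = y → g = 1 := by
  obtain ⟨x, hx⟩ := T.exists_rigid_point n
  have hr : 0 < n * T.ell := Nat.mul_pos hn (Nat.zero_lt_two.trans_le T.two_le_ell)
  -- two classes in `G / P_i` agree iff the matrices differ by a block triangular one
  have hmk : ∀ (i : Fin T.m) (a b : GL (Fin (n * T.ell)) ℂ),
      (QuotientGroup.mk (toPGL _ a) : PGL (n * T.ell) ⧸ T.parabolic n i) =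
        QuotientGroup.mk (toPGL _ b) ↔
      ((a⁻¹ * b : GL (Fin (n * T.ell)) ℂ) :
        Matrix (Fin (n * T.ell)) (Fin (n * T.ell)) ℂ).BlockTriangular fun a => T.block n i a := by
    intro i a b
    rw [QuotientGroup.eq, ← map_inv, ← map_mul, T.parabolic_eq hn, toPGL_mem_groupOfLieAlg_iff hr]
  refine ⟨fun i => QuotientGroup.mk (toPGL _ (x i)), ?_, ?_⟩
  · rw [isOpen_coinduced]
    convert isOpen_setOf_flags_isomorphic hx (T.card_belowBlocks hn) using 1
    ext g
    constructor
    · rintro ⟨k, hk⟩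
      obtain ⟨h, rfl⟩ := QuotientGroup.mk'_surjective _ k
      exact ⟨h, fun i => (hmk i _ _).1 (congrFun hk i)⟩
    · rintro ⟨h, hh⟩
      exact ⟨toPGL _ h, funext fun i => (hmk i _ _).2 (hh i)⟩
  · rintro _ ⟨k, rfl⟩ g hg
    have h1 : (k⁻¹ * g * k) • (fun i => (QuotientGroup.mk (toPGL _ (x i)) :
        PGL (n * T.ell) ⧸ T.parabolic n i)) = fun i => QuotientGroup.mk (toPGL _ (x i)) := by
      rw [mul_smul, mul_smul]
      exact inv_smul_eq_iff.2 hg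
    have h2 : k⁻¹ * g * k = 1 := by
      obtain ⟨u, hu⟩ := QuotientGroup.mk'_surjective _ (k⁻¹ * g * k)
      rw [← hu] at h1 ⊢
      obtain ⟨c, hc⟩ := hx u (fun i => by
        have := (hmk i (x i) (u * x i)).1 (congrFun h1 i).symm
        rwa [← mul_assoc, Units.val_mul, Units.val_mul] at this)
      exact toPGL_eq_one_of_scalar hc
    calc g = k * (k⁻¹ * g * k) * k⁻¹ := by group
      _ = 1 := by rw [h2]; group
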